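/- Let $k$ be a field. For a $k$-vector space $V$ and $k$-subspaces $A,B\subseteq V$ write $A<B$ if $(A+B)/B$ is finite dimensional. An endomorphism $\varphi\in\operatorname{End}_k(V)$ is finite potent if $\varphi^nV$ is finite dimensional for some $n$; its trace $\operatorname{tr}_V(\varphi)$ is then the ordinary trace of $\varphi$ on $\varphi^nV$ (which does not depend on the choice of such $n$). If $K$ is a commutative $k$-algebra, $V$ a $K$-module and $A\subseteq V$ a $k$-subspace with $fA<A$ for all $f\in K$, the abstract residue $\operatorname{res}^V_A\colon\Omega^1_{K/k}\to k$ is the unique $k$-linear map such that $\operatorname{res}^V_A(f\,dg)=\operatorname{tr}_V(f_1g_1-g_1f_1)$ for all $f,g\in K$ and all $f_1,g_1\in\operatorname{End}_k(V)$ with $f_1A<A$, $g_1A<A$, with $(f-f_1)A$ and $(g-g_1)A$ finite dimensional, and with $f_1V<A$ or $g_1V<A$. Let $K$ be a commutative $k$-algebra and $V$ a $K$-module. Let $\{V_i\}_{i\in I}$ and $\{W_i\}_{i\in I}$ be families of $k$-subspaces of $V$ such that $V_i\subseteq W_i$ and $gW_i\subseteq W_i$ for all $i\in I$ and $g\in K$.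 Assume that for every $g\in K$ one has $gV_i<V_i$ for all $i\in I$, and $gV_i=V_i$ or $gV_i=\{0\}$ for all but finitely many $i\in I$. Put $A_I=\prod_{i\in I}V_i\subseteq W_I=\prod_{i\in I}W_i$, with $K$ acting diagonally on $W_I$. Then the residue maps $\operatorname{res}^{W_I}_{A_I}$ and $\operatorname{res}^{W_i}_{V_i}$ $(i\in I)$ exist and are unique, and for all $g,h\in K$ $$\operatorname{res}^{W_I}_{A_I}(g\,dh)=\sum_{i\in I}\operatorname{res}^{W_i}_{V_i}(g\,dh),$$ where only finitely many terms of the sum are different from $0$. Consequently, if $\operatorname{res}^{W_I}_{A_I}(g\,dh)=0$, then $\sum_{i\in I}\operatorname{res}^{W_i}_{V_i}(g\,dh)=0$ (in particular this holds for all $g,h\in K$ if $\operatorname{res}^{W_I}_{A_I}=0$). -/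

import Mathlib

open scoped KaehlerDifferential

namespace TateResidue

section Trace

variable {k V : Type*} [Field k] [AddCommGroup V] [Module k V]

/-- `φ` is finite potent: `φ ^ n V` is finite dimensional for some `n`. -/
abbrev IsFinitePotent (φ : Module.End k V) : Prop :=
  ∃ n : ℕ, FiniteDimensional k (LinearMap.range (φ ^ n))

/-- The subspace `φ ^ n V` is stable under `φ`. -/
theorem mapsTo_range_pow (φ : Module.End k V) (n : ℕ) :
    ∀ x ∈ LinearMap.range (φ ^ n), φ x ∈ LinearMap.range (φ ^ n) := by
  rintro _ ⟨y, rfl⟩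
  refine ⟨φ y, ?_⟩
  rw [← Module.End.mul_apply, ← Module.End.mul_apply, ← pow_succ, ← pow_succ']

open Classical in
/-- The trace `tr_V φ` of a finite potent endomorphism: the ordinary trace of `φ` on the finite
dimensional stable subspace `φ ^ n V`, for the least `n` for which that space is finite dimensional
(any other such `n` gives the same value). It is only meaningful for finite potent `φ`. -/
noncomputable def finitePotentTrace (φ : Module.End k V) : k :=
  if h : IsFinitePotent φ then
    LinearMap.trace k (LinearMap.range (φ ^ Nat.find h))
      (φ.restrict (mapsTo_range_pow φ (Nat.find h)))
  else 0

/-- The relation `A < B`: the space `(A + B) / B`, seen inside `V / B`, is finite dimensional. -/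
def AlmostLE (A B : Submodule k V) : Prop :=
  FiniteDimensional k ((A ⊔ B).map B.mkQ)

/-- `E`: the endomorphisms `φ` of `V` with `φ A < A`. -/
def setE (A : Submodule k V) : Set (Module.End k V) :=
  {φ | AlmostLE (A.map φ) A}

/-- `E₁`: the endomorphisms `φ` of `V` with `φ V < A`. -/
def setE₁ (A : Submodule k V) : Set (Module.End k V) :=
  {φ | AlmostLE ((⊤ : Submodule k V).map φ) A}

/-- `E₂`: the endomorphisms `φ` of `V` with `φ A < (0)`. -/
def setE₂ (A : Submodule k V) : Set (Module.End k V) :=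
  {φ | AlmostLE (A.map φ) ⊥}

/-- `E (V, {V_i})`: the endomorphisms `g` with `g V_i < V_i` for all `i`, and with
`g V_i = V_i` or `g V_i = 0` for all but finitely many `i`. -/
def restrictedEnd {I : Type*} (Vs : I → Submodule k V) : Set (Module.End k V) :=
  {g | (∀ i, AlmostLE ((Vs i).map g) (Vs i)) ∧
    {i | ¬ ((Vs i).map g = Vs i ∨ (Vs i).map g = ⊥)}.Finite}

end Trace

section Residue

variable (k K : Type*) {V : Type*} [Field k] [CommRing K] [Algebra k K]
  [AddCommGroup V] [Module k V] [Module K V] [IsScalarTower k K V]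

/-- The endomorphism of the `k`-vector space `V` by which `f : K` acts. -/
noncomputable abbrev act (f : K) : Module.End k V := Algebra.lsmul k k V f

/-- The property that characterizes the residue map `res_A^V : Ω_{K/k} → k`:
`res_A^V (f dg) = tr_V [f₁, g₁]` for all `f₁, g₁ ∈ E` with `f ≡ f₁` and `g ≡ g₁` modulo `E₂`
such that `f₁ ∈ E₁` or `g₁ ∈ E₁`. -/
def IsResidue (A : Submodule k V) (r : Ω[K⁄k] →ₗ[k] k) : Prop :=
  ∀ (f g : K) (f₁ g₁ : Module.End k V), f₁ ∈ setE A → g₁ ∈ setE A →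
    act k K f - f₁ ∈ setE₂ A → act k K g - g₁ ∈ setE₂ A →
    (f₁ ∈ setE₁ A ∨ g₁ ∈ setE₁ A) →
    r (f • KaehlerDifferential.D k K g) = finitePotentTrace (f₁ * g₁ - g₁ * f₁)

open Classical in
/-- The abstract residue `res_A^V : Ω_{K/k} → k`, that is, the `k`-linear map with the property
`IsResidue`; such a map exists and is unique as soon as `f A < A` for all `f : K`. -/
noncomputable def res (A : Submodule k V) : Ω[K⁄k] →ₗ[k] k :=
  if h : ∃ r : Ω[K⁄k] →ₗ[k] k, IsResidue k K A r then h.choose else 0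

variable {K} {I : Type*}

/-- `V_i` as a `k`-subspace of `W_i` (used when `V_i ⊆ W_i`). -/
def localSubspace (Vs : I → Submodule k V) (W : I → Submodule K V) (i : I) :
    Submodule k (W i) :=
  (Vs i).comap ((W i).subtype.restrictScalars k)

/-- `A_I = ∏ V_i` as a `k`-subspace of `W_I = ∏ W_i`. -/
def productSubspace (Vs : I → Submodule k V) (W : I → Submodule K V) :
    Submodule k ((i : I) → W i) :=
  Submodule.pi Set.univ (localSubspace k Vs W)

end Residue

end TateResidue

/-! Fix a `k`-linear projection `π` of the ambient space onto `A`. The truncation `π f` lies in `E₁`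
and agrees with `f` modulo `E₂`, so the residue of `f dg` is the trace of `[π f, π g]`. Projections
`π i` onto the `V_i` assemble into a projection `piEnd π` onto `A_I`, and the commutator on `W_I`
then acts factorwise. Outside a finite set of indices both `g` and `h` preserve `V_i`. There the
truncated commutator maps into `V_i` and kills it because `g` and `h` commute, so its square is
zero. These factors together form one endomorphism of square zero, of trace zero, and additivity of
the trace on `E₀` leaves a finite sum (`finitePotentTrace_piEnd`).

Existence of residues rests on two facts: the trace is linear on `E₀ = E₁ ∩ E₂`, where any product
of two elements has finite rank, and it vanishes on `[E₁, E₂]`. Hence the trace of `[f₁, g₁]` is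
independent of the lifts (`commutator_trace_congr`), and a commutator identity gives the Leibniz
rule (`exists_isResidue`). Uniqueness holds because the `f dg` span the differentials. -/

namespace TateResidue

/-! ### Inclusion of subspaces up to finite dimension. -/

section AlmostLE

variable {k V W : Type*} [Field k] [AddCommGroup V] [Module k V] [AddCommGroup W] [Module k W]

/-- A linear section of `V → V / Y` lifts the finite dimensional quotient to an error space `F`; in
this form errors simply add up. -/
theorem almostLE_iff {X Y : Submodule k V} :
    AlmostLE X Y ↔ ∃ F : Submodule k V, FiniteDimensional k F ∧ X ≤ Y ⊔ F := by
  constructor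
  · intro h
    obtain ⟨s, hs⟩ := Y.mkQ.exists_rightInverse_of_surjective (Submodule.range_mkQ Y)
    have h' : FiniteDimensional k ((X ⊔ Y).map Y.mkQ) := h
    refine ⟨((X ⊔ Y).map Y.mkQ).map s, inferInstance, fun x hx => ?_⟩
    have hsx : Y.mkQ (s (Y.mkQ x)) = Y.mkQ x := LinearMap.congr_fun hs (Y.mkQ x)
    have h1 : x - s (Y.mkQ x) ∈ Y := by
      refine (Submodule.Quotient.mk_eq_zero Y).1 ?_
      rw [← Submodule.mkQ_apply, map_sub, hsx, sub_self]
    rw [← sub_add_cancel x (s (Y.mkQ x))]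
    exact Submodule.add_mem_sup h1
      (Submodule.mem_map_of_mem (Submodule.mem_map_of_mem (Submodule.mem_sup_left hx)))
  · rintro ⟨F, hF, hX⟩
    have h : (X ⊔ Y).map Y.mkQ ≤ F.map Y.mkQ := by
      have : F.map Y.mkQ = (Y ⊔ F).map Y.mkQ := by simp [Submodule.map_sup]
      rw [this]
      exact Submodule.map_mono (sup_le hX le_sup_left)
    exact Submodule.finiteDimensional_of_le h

theorem AlmostLE.of_le {X Y : Submodule k V} (h : X ≤ Y) : AlmostLE X Y :=
  almostLE_iff.2 ⟨⊥, inferInstance, h.trans le_sup_left⟩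

theorem AlmostLE.mono_left {X X' Y : Submodule k V} (hX : X' ≤ X) (h : AlmostLE X Y) :
    AlmostLE X' Y :=
  let ⟨F, hF, hXF⟩ := almostLE_iff.1 h
  almostLE_iff.2 ⟨F, hF, hX.trans hXF⟩

theorem AlmostLE.trans {X Y Z : Submodule k V} (h : AlmostLE X Y) (h' : AlmostLE Y Z) :
    AlmostLE X Z := by
  obtain ⟨F, hF, hXF⟩ := almostLE_iff.1 h
  obtain ⟨G, hG, hYG⟩ := almostLE_iff.1 h'
  exact almostLE_iff.2 ⟨G ⊔ F, inferInstance,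
    hXF.trans ((sup_le_sup_right hYG F).trans_eq (sup_assoc _ _ _))⟩

theorem AlmostLE.sup {X Y Z : Submodule k V} (h : AlmostLE X Z) (h' : AlmostLE Y Z) :
    AlmostLE (X ⊔ Y) Z := by
  obtain ⟨F, hF, hXF⟩ := almostLE_iff.1 h
  obtain ⟨G, hG, hYG⟩ := almostLE_iff.1 h'
  exact almostLE_iff.2 ⟨F ⊔ G, inferInstance,
    sup_le (hXF.trans (sup_le_sup_left le_sup_left _)) (hYG.trans (sup_le_sup_left le_sup_right _))⟩

theorem AlmostLE.map {X Y : Submodule k V} (h : AlmostLE X Y) (φ : V →ₗ[k] W) :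
    AlmostLE (X.map φ) (Y.map φ) := by
  obtain ⟨F, hF, hXF⟩ := almostLE_iff.1 h
  exact almostLE_iff.2 ⟨F.map φ, inferInstance, by
    rw [← Submodule.map_sup]; exact Submodule.map_mono hXF⟩

theorem AlmostLE.of_map {X Y : Submodule k V} (φ : V →ₗ[k] W) (hφ : Function.Injective φ)
    (h : AlmostLE (X.map φ) (Y.map φ)) : AlmostLE X Y := by
  obtain ⟨ρ, hρ⟩ := φ.exists_leftInverse_of_injective (LinearMap.ker_eq_bot.2 hφ)
  have := h.map ρ
  rwa [← Submodule.map_comp, ← Submodule.map_comp, hρ, Submodule.map_id, Submodule.map_id] at this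

theorem almostLE_bot_iff {X : Submodule k V} : AlmostLE X ⊥ ↔ FiniteDimensional k X := by
  rw [almostLE_iff]
  constructor
  · rintro ⟨F, hF, h⟩
    rw [bot_sup_eq] at h
    exact Submodule.finiteDimensional_of_le h
  · exact fun h => ⟨X, h, le_sup_right⟩

theorem map_add_le (X : Submodule k V) (φ ψ : V →ₗ[k] W) :
    X.map (φ + ψ) ≤ X.map φ ⊔ X.map ψ := by
  rintro _ ⟨x, hx, rfl⟩
  exact Submodule.add_mem_sup (Submodule.mem_map_of_mem hx) (Submodule.mem_map_of_mem hx)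

theorem map_smul_le' (X : Submodule k V) (c : k) (φ : V →ₗ[k] W) :
    X.map (c • φ) ≤ X.map φ := by
  rintro _ ⟨x, hx, rfl⟩
  exact Submodule.smul_mem _ c (Submodule.mem_map_of_mem hx)

/-- The linear maps `φ : V → W` with `φ X < Y`. -/
def almostMapsTo (X : Submodule k V) (Y : Submodule k W) : Submodule k (V →ₗ[k] W) where
  carrier := {φ | AlmostLE (X.map φ) Y}
  add_mem' hφ hψ := (AlmostLE.sup hφ hψ).mono_left (map_add_le _ _ _)
  zero_mem' := AlmostLE.of_le (by simp)
  smul_mem' c φ hφ := AlmostLE.mono_left (map_smul_le' X c φ) hφ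

theorem mem_almostMapsTo {X : Submodule k V} {Y : Submodule k W} {φ : V →ₗ[k] W} :
    φ ∈ almostMapsTo X Y ↔ AlmostLE (X.map φ) Y := Iff.rfl

/-- `E`, `E₁` and `E₂` are the cases `(A, A)`, `(⊤, A)` and `(A, ⊥)`, so this one rule yields all
their ideal properties. -/
theorem mul_mem_almostMapsTo {X Y Z : Submodule k V} {φ ψ : Module.End k V}
    (hφ : φ ∈ almostMapsTo Y Z) (hψ : ψ ∈ almostMapsTo X Y) : φ * ψ ∈ almostMapsTo X Z := by
  rw [mem_almostMapsTo, Module.End.mul_eq_comp, Submodule.map_comp]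
  exact (AlmostLE.map hψ φ).trans hφ

theorem almostMapsTo_anti {X X' Y : Submodule k V} (h : X' ≤ X) :
    almostMapsTo X Y ≤ almostMapsTo X' Y := fun _ hφ =>
  AlmostLE.mono_left (Submodule.map_mono h) hφ

theorem almostMapsTo_mono {X Y Y' : Submodule k V} (h : Y ≤ Y') :
    almostMapsTo X Y ≤ almostMapsTo X Y' := fun _ hφ =>
  AlmostLE.trans hφ (AlmostLE.of_le h)

theorem mem_almostMapsTo_of_le {X : Submodule k V} {Y : Submodule k W} {φ : V →ₗ[k] W}
    (h : X.map φ ≤ Y) : φ ∈ almostMapsTo X Y := AlmostLE.of_le h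

end AlmostLE

/-! ### Traces of finite potent endomorphisms. -/

section Trace

variable {k V W : Type*} [Field k] [AddCommGroup V] [Module k V] [AddCommGroup W] [Module k W]

/-- Since `φ` maps `N` into `R`, the two restrictions are `e ∘ g` and `g ∘ e`. -/
theorem trace_restrict_eq_of_le (φ : Module.End k V) {N R : Submodule k V}
    [FiniteDimensional k N] [FiniteDimensional k R]
    (hN : ∀ x ∈ N, φ x ∈ N) (hR : ∀ x ∈ R, φ x ∈ R) (hRN : R ≤ N) (h : N.map φ ≤ R) :
    LinearMap.trace k N (φ.restrict hN) = LinearMap.trace k R (φ.restrict hR) := by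
  let e : R →ₗ[k] N := Submodule.inclusion hRN
  let g : N →ₗ[k] R := φ.restrict fun x hx => h (Submodule.mem_map_of_mem hx)
  have h1 : φ.restrict hN = e ∘ₗ g := rfl
  have h2 : φ.restrict hR = g ∘ₗ e := rfl
  rw [h1, h2, LinearMap.trace_comp_comm']

/-- Replacing `N` by `φ N + R` keeps the trace and lowers the exponent `m` by one. -/
theorem trace_restrict_eq_of_pow (φ : Module.End k V) {R : Submodule k V}
    [FiniteDimensional k R] (hR : ∀ x ∈ R, φ x ∈ R) (m : ℕ) :
    ∀ (N : Submodule k V) [FiniteDimensional k N] (hN : ∀ x ∈ N, φ x ∈ N) (_ : R ≤ N)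
      (_ : N.map (φ ^ m) ≤ R),
      LinearMap.trace k N (φ.restrict hN) = LinearMap.trace k R (φ.restrict hR) := by
  induction m with
  | zero =>
    intro N _ hN hRN h
    obtain rfl : R = N := le_antisymm hRN (by simpa [Module.End.one_eq_id] using h)
    rfl
  | succ m ih =>
    intro N _ hN hRN h
    have hsup : N.map φ ⊔ R ≤ N := sup_le (Submodule.map_le_iff_le_comap.2 hN) hRN
    have hN' : ∀ x ∈ N.map φ ⊔ R, φ x ∈ N.map φ ⊔ R := fun x hx =>
      Submodule.mem_sup_left (Submodule.mem_map_of_mem (hsup hx))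
    rw [trace_restrict_eq_of_le φ hN hN' hsup le_sup_left]
    refine ih _ hN' le_sup_right ?_
    rw [Submodule.map_sup, ← Submodule.map_comp, ← Module.End.mul_eq_comp, ← pow_succ]
    refine sup_le h (Submodule.map_le_iff_le_comap.2 fun x hx => ?_)
    rw [Submodule.mem_comap, Module.End.coe_pow]
    exact (show Set.MapsTo φ R R from hR).iterate m hx

/-- The trace of a finite potent endomorphism can be computed on any finite dimensional stable
subspace that contains the range of some power. -/
theorem finitePotentTrace_eq (φ : Module.End k V) (N : Submodule k V) [FiniteDimensional k N]
    (hN : ∀ x ∈ N, φ x ∈ N) (m : ℕ) (hm : LinearMap.range (φ ^ m) ≤ N) :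
    finitePotentTrace φ = LinearMap.trace k N (φ.restrict hN) := by
  have hφ : IsFinitePotent φ := ⟨m, Submodule.finiteDimensional_of_le hm⟩
  classical
  obtain ⟨n, hn, hn'⟩ : ∃ n, ∃ _ : FiniteDimensional k (LinearMap.range (φ ^ n)),
      finitePotentTrace φ = LinearMap.trace k (LinearMap.range (φ ^ n))
        (φ.restrict (mapsTo_range_pow φ n)) := by
    refine ⟨Nat.find hφ, Nat.find_spec hφ, ?_⟩
    unfold finitePotentTrace
    rw [dif_pos hφ]
  rw [hn']
  -- The two subspaces need not be comparable, so both are compared with their sum.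
  have hsup : ∀ x ∈ LinearMap.range (φ ^ n) ⊔ N, φ x ∈ LinearMap.range (φ ^ n) ⊔ N := by
    intro x hx
    obtain ⟨y, hy, z, hz, rfl⟩ := Submodule.mem_sup.1 hx
    rw [map_add]
    exact Submodule.add_mem_sup (mapsTo_range_pow φ n y hy) (hN z hz)
  rw [← trace_restrict_eq_of_pow φ hN m _ hsup le_sup_right
      (LinearMap.map_le_range.trans hm),
    ← trace_restrict_eq_of_pow φ (mapsTo_range_pow φ n) n _ hsup le_sup_left
      LinearMap.map_le_range]

theorem finitePotentTrace_of_sq_eq_zero (φ : Module.End k V) (h : φ * φ = 0) :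
    finitePotentTrace φ = 0 := by
  rw [finitePotentTrace_eq φ ⊥ (by simp) 2 (by simp [pow_two, h])]
  rw [Subsingleton.elim (φ.restrict _) 0, map_zero]

theorem finitePotentTrace_comp_comm (φ : V →ₗ[k] W) (ψ : W →ₗ[k] V)
    (h : IsFinitePotent (φ ∘ₗ ψ : Module.End k W)) :
    finitePotentTrace (φ ∘ₗ ψ : Module.End k W) = finitePotentTrace (ψ ∘ₗ φ : Module.End k V) := by
  obtain ⟨m, hm⟩ := h
  set N := LinearMap.range ((φ ∘ₗ ψ : Module.End k W) ^ m) with hNdef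
  have hN := mapsTo_range_pow (φ ∘ₗ ψ : Module.End k W) m
  have hφ : ∀ x ∈ N.map ψ, φ x ∈ N := by
    rintro _ ⟨y, hy, rfl⟩
    exact hN y hy
  have hpow : ∀ x, ((ψ ∘ₗ φ : Module.End k V) ^ m) (ψ x) =
      ψ (((φ ∘ₗ ψ : Module.End k W) ^ m) x) := by
    intro x
    simp only [Module.End.coe_pow]
    exact (Function.Semiconj.iterate_right (f := ψ) (fun y => rfl) m x).symm
  have hN' : ∀ x ∈ N.map ψ, (ψ ∘ₗ φ : Module.End k V) x ∈ N.map ψ := fun x hx =>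
    Submodule.mem_map_of_mem (hφ x hx)
  -- The exponent is `m + 1` because `(ψ φ) ^ (m + 1) = ψ (φ ψ) ^ m φ`.
  rw [finitePotentTrace_eq _ N hN m le_rfl, finitePotentTrace_eq _ (N.map ψ) hN' (m + 1) (by
    rintro _ ⟨x, rfl⟩
    rw [pow_succ, Module.End.mul_apply]
    exact ⟨_, ⟨φ x, rfl⟩, (hpow _).symm⟩)]
  let a : (N.map ψ) →ₗ[k] N := φ.restrict hφ
  let b : N →ₗ[k] (N.map ψ) := ψ.restrict fun x hx => Submodule.mem_map_of_mem hx
  exact LinearMap.trace_comp_comm' b a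

/-- A sum of finite potent maps need not be finite potent. Here the images of the four products span
a finite dimensional space stable under both maps, on which all three traces can be computed. -/
theorem finitePotentTrace_add (φ ψ : Module.End k V)
    (h₁ : FiniteDimensional k (LinearMap.range (φ * φ)))
    (h₂ : FiniteDimensional k (LinearMap.range (φ * ψ)))
    (h₃ : FiniteDimensional k (LinearMap.range (ψ * φ)))
    (h₄ : FiniteDimensional k (LinearMap.range (ψ * ψ))) :
    finitePotentTrace (φ + ψ) = finitePotentTrace φ + finitePotentTrace ψ := by
  set N := (LinearMap.range (φ * φ) ⊔ LinearMap.range (φ * ψ)) ⊔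
    (LinearMap.range (ψ * φ) ⊔ LinearMap.range (ψ * ψ)) with hN
  have m₁ : ∀ x, φ (φ x) ∈ N := fun x =>
    Submodule.mem_sup_left (Submodule.mem_sup_left ⟨x, rfl⟩)
  have m₂ : ∀ x, φ (ψ x) ∈ N := fun x =>
    Submodule.mem_sup_left (Submodule.mem_sup_right ⟨x, rfl⟩)
  have m₃ : ∀ x, ψ (φ x) ∈ N := fun x =>
    Submodule.mem_sup_right (Submodule.mem_sup_left ⟨x, rfl⟩)
  have m₄ : ∀ x, ψ (ψ x) ∈ N := fun x =>
    Submodule.mem_sup_right (Submodule.mem_sup_right ⟨x, rfl⟩)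
  have hle : N ≤ LinearMap.range φ ⊔ LinearMap.range ψ := by
    refine sup_le (sup_le ?_ ?_) (sup_le ?_ ?_)
    · exact (LinearMap.range_comp_le_range φ φ).trans le_sup_left
    · exact (LinearMap.range_comp_le_range ψ φ).trans le_sup_left
    · exact (LinearMap.range_comp_le_range φ ψ).trans le_sup_right
    · exact (LinearMap.range_comp_le_range ψ ψ).trans le_sup_right
  have hφ : ∀ x ∈ N, φ x ∈ N := by
    intro x hx
    obtain ⟨_, ⟨y, rfl⟩, _, ⟨z, rfl⟩, rfl⟩ := Submodule.mem_sup.1 (hle hx)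
    rw [map_add]
    exact add_mem (m₁ y) (m₂ z)
  have hψ : ∀ x ∈ N, ψ x ∈ N := by
    intro x hx
    obtain ⟨_, ⟨y, rfl⟩, _, ⟨z, rfl⟩, rfl⟩ := Submodule.mem_sup.1 (hle hx)
    rw [map_add]
    exact add_mem (m₃ y) (m₄ z)
  rw [finitePotentTrace_eq φ N hφ 2 (by rintro _ ⟨x, rfl⟩; rw [pow_two]; exact m₁ x),
    finitePotentTrace_eq ψ N hψ 2 (by rintro _ ⟨x, rfl⟩; rw [pow_two]; exact m₄ x),
    finitePotentTrace_eq (φ + ψ) N (fun x hx => add_mem (hφ x hx) (hψ x hx)) 2 (by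
      rintro _ ⟨x, rfl⟩
      rw [pow_two, Module.End.mul_apply]
      simp only [LinearMap.add_apply, map_add]
      exact add_mem (add_mem (m₁ x) (m₃ x)) (add_mem (m₂ x) (m₄ x))), ← map_add]
  rfl

theorem finitePotentTrace_smul (c : k) (φ : Module.End k V) (h : IsFinitePotent φ) :
    finitePotentTrace (c • φ) = c * finitePotentTrace φ := by
  obtain ⟨m, hm⟩ := h
  have hN := mapsTo_range_pow φ m
  rw [finitePotentTrace_eq φ _ hN m le_rfl,
    finitePotentTrace_eq (c • φ) _ (fun x hx => Submodule.smul_mem _ c (hN x hx)) m (by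
      rintro _ ⟨x, rfl⟩
      rw [smul_pow]
      exact Submodule.smul_mem _ _ ⟨x, rfl⟩), ← smul_eq_mul, ← map_smul]
  rfl

end Trace

/-! ### The space `E₀` and traces of commutators. -/

section Trace

variable {k V : Type*} [Field k] [AddCommGroup V] [Module k V]

/-- `E₀ = E₁ ∩ E₂`: the endomorphisms `φ` of `V` with `φ V < A` and `φ A < (0)`. -/
def setE₀ (A : Submodule k V) : Submodule k (Module.End k V) :=
  almostMapsTo ⊤ A ⊓ almostMapsTo A ⊥

variable {A : Submodule k V} {φ ψ : Module.End k V}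

theorem setE₁_subset_setE : setE₁ A ⊆ setE A := almostMapsTo_anti (Y := A) le_top

theorem setE₂_subset_setE : setE₂ A ⊆ setE A := almostMapsTo_mono (X := A) bot_le

theorem mul_mem_setE₀_of_E₁_E₂ (hφ : φ ∈ setE₁ A) (hψ : ψ ∈ setE₂ A) : φ * ψ ∈ setE₀ A :=
  ⟨mul_mem_almostMapsTo (Y := ⊤) hφ (mem_almostMapsTo_of_le le_top),
    mul_mem_almostMapsTo (Y := ⊥) (mem_almostMapsTo_of_le (by simp)) hψ⟩

theorem mul_mem_setE₀_of_E₂_E₁ (hφ : φ ∈ setE₂ A) (hψ : ψ ∈ setE₁ A) : φ * ψ ∈ setE₀ A :=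
  ⟨mul_mem_almostMapsTo (Y := A) (setE₂_subset_setE hφ) hψ,
    mul_mem_almostMapsTo (Y := A) hφ (setE₁_subset_setE hψ)⟩

theorem mul_mem_setE₀_of_E_E₀ (hφ : φ ∈ setE A) (hψ : ψ ∈ setE₀ A) : φ * ψ ∈ setE₀ A :=
  ⟨mul_mem_almostMapsTo (Y := A) hφ hψ.1,
    mul_mem_almostMapsTo (Y := ⊥) (mem_almostMapsTo_of_le (by simp)) hψ.2⟩

/-- `ψ` sends everything almost into `A`, and `φ` has finite rank on `A`. -/
theorem finiteDimensional_range_mul (hφ : φ ∈ setE₀ A) (hψ : ψ ∈ setE₀ A) :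
    FiniteDimensional k (LinearMap.range (φ * ψ)) := by
  have h : φ * ψ ∈ almostMapsTo ⊤ (⊥ : Submodule k V) := mul_mem_almostMapsTo hφ.2 hψ.1
  rw [mem_almostMapsTo, almostLE_bot_iff] at h
  rwa [← Submodule.map_top]

theorem isFinitePotent_of_mem_setE₀ (hφ : φ ∈ setE₀ A) : IsFinitePotent φ :=
  ⟨2, by rw [pow_two]; exact finiteDimensional_range_mul hφ hφ⟩

variable (A) in
/-- The trace as a linear functional on `E₀`. -/
noncomputable def traceE₀ : setE₀ A →ₗ[k] k where
  toFun φ := finitePotentTrace φ.1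
  map_add' φ ψ := finitePotentTrace_add _ _ (finiteDimensional_range_mul φ.2 φ.2)
    (finiteDimensional_range_mul φ.2 ψ.2) (finiteDimensional_range_mul ψ.2 φ.2)
    (finiteDimensional_range_mul ψ.2 ψ.2)
  map_smul' c φ := finitePotentTrace_smul c _ (isFinitePotent_of_mem_setE₀ φ.2)

theorem finitePotentTrace_add_of_mem (hφ : φ ∈ setE₀ A) (hψ : ψ ∈ setE₀ A) :
    finitePotentTrace (φ + ψ) = finitePotentTrace φ + finitePotentTrace ψ :=
  (traceE₀ A).map_add ⟨φ, hφ⟩ ⟨ψ, hψ⟩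

theorem finitePotentTrace_sub_of_mem (hφ : φ ∈ setE₀ A) (hψ : ψ ∈ setE₀ A) :
    finitePotentTrace (φ - ψ) = finitePotentTrace φ - finitePotentTrace ψ :=
  (traceE₀ A).map_sub ⟨φ, hφ⟩ ⟨ψ, hψ⟩

theorem finitePotentTrace_sum_of_mem {I : Type*} (s : Finset I) (φ : I → Module.End k V)
    (hφ : ∀ i, φ i ∈ setE₀ A) :
    finitePotentTrace (∑ i ∈ s, φ i) = ∑ i ∈ s, finitePotentTrace (φ i) := by
  have h : ((∑ i ∈ s, (⟨φ i, hφ i⟩ : setE₀ A) : setE₀ A) : Module.End k V) = ∑ i ∈ s, φ i := by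
    rw [Submodule.coe_sum]
  rw [← h]
  exact map_sum (traceE₀ A) (fun i => (⟨φ i, hφ i⟩ : setE₀ A)) s

theorem finitePotentTrace_commutator_eq_zero (h : φ * ψ ∈ setE₀ A) (h' : ψ * φ ∈ setE₀ A) :
    finitePotentTrace (φ * ψ - ψ * φ) = 0 := by
  rw [finitePotentTrace_sub_of_mem h h', sub_eq_zero]
  exact finitePotentTrace_comp_comm φ ψ (isFinitePotent_of_mem_setE₀ h)

theorem commutator_eq_zero_of_E₁_E₂ (hφ : φ ∈ setE₁ A) (hψ : ψ ∈ setE₂ A) :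
    finitePotentTrace (φ * ψ - ψ * φ) = 0 :=
  finitePotentTrace_commutator_eq_zero (mul_mem_setE₀_of_E₁_E₂ hφ hψ)
    (mul_mem_setE₀_of_E₂_E₁ hψ hφ)

theorem commutator_mem_setE₀_of_E₁_E₂ (hφ : φ ∈ setE₁ A) (hψ : ψ ∈ setE₂ A) :
    φ * ψ - ψ * φ ∈ setE₀ A :=
  sub_mem (mul_mem_setE₀_of_E₁_E₂ hφ hψ) (mul_mem_setE₀_of_E₂_E₁ hψ hφ)

/-- Lifts modulo `E₂` of commuting endomorphisms commute modulo `E₂`. -/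
theorem commutator_mem_setE₂ {f g f₁ g₁ : Module.End k V} (hfg : f * g = g * f)
    (hf₁ : f₁ ∈ setE A) (hg₁ : g₁ ∈ setE A) (hf : f - f₁ ∈ setE₂ A) (hg : g - g₁ ∈ setE₂ A) :
    f₁ * g₁ - g₁ * f₁ ∈ setE₂ A := by
  have top : ∀ φ : Module.End k V, φ ∈ almostMapsTo (⊥ : Submodule k V) (⊥ : Submodule k V) :=
    fun φ => mem_almostMapsTo_of_le (by simp)
  -- Both sides are `(g f - g₁ f₁) - (f g - f₁ g₁)`; the right one shows an error factor in each
  -- term.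
  have h : f₁ * g₁ - g₁ * f₁ =
      (g * (f - f₁) + (g - g₁) * f₁) - (f * (g - g₁) + (f - f₁) * g₁) := by
    simp only [mul_sub, sub_mul, hfg]
    abel
  rw [h]
  exact (almostMapsTo A ⊥).sub_mem
    (add_mem (mul_mem_almostMapsTo (top g) hf) (mul_mem_almostMapsTo (Y := A) hg hf₁))
    (add_mem (mul_mem_almostMapsTo (top f) hg) (mul_mem_almostMapsTo (Y := A) hf hg₁))

theorem commutator_mem_setE₁ {f₁ g₁ : Module.End k V}
    (hf₁ : f₁ ∈ setE A) (hg₁ : g₁ ∈ setE A) (h : f₁ ∈ setE₁ A ∨ g₁ ∈ setE₁ A) :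
    f₁ * g₁ - g₁ * f₁ ∈ setE₁ A := by
  have key : ∀ {φ ψ : Module.End k V}, φ ∈ setE₁ A → ψ ∈ setE A →
      φ * ψ ∈ almostMapsTo ⊤ A ∧ ψ * φ ∈ almostMapsTo ⊤ A := fun hφ hψ =>
    ⟨mul_mem_almostMapsTo (Y := ⊤) hφ (mem_almostMapsTo_of_le le_top),
      mul_mem_almostMapsTo (Y := A) hψ hφ⟩
  refine (almostMapsTo ⊤ A).sub_mem ?_ ?_
  · exact h.elim (fun h => (key h hg₁).1) (fun h => (key h hf₁).2)
  · exact h.elim (fun h => (key h hg₁).2) (fun h => (key h hf₁).1)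

theorem commutator_mem_setE₀ {f g f₁ g₁ : Module.End k V} (hfg : f * g = g * f)
    (hf₁ : f₁ ∈ setE A) (hg₁ : g₁ ∈ setE A) (hf : f - f₁ ∈ setE₂ A) (hg : g - g₁ ∈ setE₂ A)
    (h : f₁ ∈ setE₁ A ∨ g₁ ∈ setE₁ A) : f₁ * g₁ - g₁ * f₁ ∈ setE₀ A :=
  ⟨commutator_mem_setE₁ hf₁ hg₁ h, commutator_mem_setE₂ hfg hf₁ hg₁ hf hg⟩

theorem sub_mem_setE₂_of_sub {f f₁ f₂ : Module.End k V} (h₁ : f - f₁ ∈ setE₂ A)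
    (h₂ : f - f₂ ∈ setE₂ A) : f₁ - f₂ ∈ setE₂ A := by
  have h := (almostMapsTo A ⊥).sub_mem h₂ h₁
  rwa [sub_sub_sub_cancel_left] at h

/-- The commutator changes by `[f₁, g₁ - g₂]`, an element of `[E₁, E₂]`. -/
theorem commutator_trace_congr_right {f g f₁ g₁ g₂ : Module.End k V} (hfg : f * g = g * f)
    (hf₁ : f₁ ∈ setE₁ A) (hg₂ : g₂ ∈ setE A)
    (hf : f - f₁ ∈ setE₂ A) (hg : g - g₁ ∈ setE₂ A) (hg' : g - g₂ ∈ setE₂ A) :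
    finitePotentTrace (f₁ * g₁ - g₁ * f₁) = finitePotentTrace (f₁ * g₂ - g₂ * f₁) := by
  have hd := sub_mem_setE₂_of_sub hg hg'
  have h : f₁ * g₁ - g₁ * f₁ =
      (f₁ * g₂ - g₂ * f₁) + (f₁ * (g₁ - g₂) - (g₁ - g₂) * f₁) := by
    simp only [mul_sub, sub_mul]
    abel
  rw [h, finitePotentTrace_add_of_mem
    (commutator_mem_setE₀ hfg (setE₁_subset_setE hf₁) hg₂ hf hg' (Or.inl hf₁))
    (commutator_mem_setE₀_of_E₁_E₂ hf₁ hd), commutator_eq_zero_of_E₁_E₂ hf₁ hd, add_zero]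

theorem finitePotentTrace_commutator_swap {f g f₁ g₁ : Module.End k V} (hfg : f * g = g * f)
    (hf₁ : f₁ ∈ setE A) (hg₁ : g₁ ∈ setE A) (hf : f - f₁ ∈ setE₂ A) (hg : g - g₁ ∈ setE₂ A)
    (h : f₁ ∈ setE₁ A ∨ g₁ ∈ setE₁ A) :
    finitePotentTrace (g₁ * f₁ - f₁ * g₁) = -finitePotentTrace (f₁ * g₁ - g₁ * f₁) := by
  rw [← neg_sub]
  exact (traceE₀ A).map_neg ⟨_, commutator_mem_setE₀ hfg hf₁ hg₁ hf hg h⟩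

/-- The trace of the commutator of lifts does not depend on the lifts. -/
theorem commutator_trace_congr {f g f₁ g₁ f₂ g₂ : Module.End k V} (hfg : f * g = g * f)
    (hf₁ : f₁ ∈ setE A) (hg₁ : g₁ ∈ setE A) (hf : f - f₁ ∈ setE₂ A) (hg : g - g₁ ∈ setE₂ A)
    (h : f₁ ∈ setE₁ A ∨ g₁ ∈ setE₁ A)
    (hf₂ : f₂ ∈ setE₁ A) (hg₂ : g₂ ∈ setE₁ A) (hf' : f - f₂ ∈ setE₂ A) (hg' : g - g₂ ∈ setE₂ A) :
    finitePotentTrace (f₁ * g₁ - g₁ * f₁) = finitePotentTrace (f₂ * g₂ - g₂ * f₂) := by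
  -- Lifts are exchanged one at a time, `g₁` while `f₁ ∈ E₁` is held fixed, then `f₁` while `g₂ ∈
  -- E₁` is; antisymmetry reduces the other case to this one.
  have key : ∀ {f g f₁ g₁ f₂ g₂ : Module.End k V}, f * g = g * f → f₁ ∈ setE₁ A →
      f - f₁ ∈ setE₂ A → g - g₁ ∈ setE₂ A → f₂ ∈ setE₁ A → g₂ ∈ setE₁ A →
      f - f₂ ∈ setE₂ A → g - g₂ ∈ setE₂ A →
      finitePotentTrace (f₁ * g₁ - g₁ * f₁) = finitePotentTrace (f₂ * g₂ - g₂ * f₂) := by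
    intro f g f₁ g₁ f₂ g₂ hfg hf₁ hf hg hf₂ hg₂ hf' hg'
    rw [commutator_trace_congr_right hfg hf₁ (setE₁_subset_setE hg₂) hf hg hg',
      finitePotentTrace_commutator_swap hfg.symm (setE₁_subset_setE hg₂) (setE₁_subset_setE hf₁)
        hg' hf (Or.inl hg₂),
      commutator_trace_congr_right hfg.symm hg₂ (setE₁_subset_setE hf₂) hg' hf hf',
      ← finitePotentTrace_commutator_swap hfg.symm (setE₁_subset_setE hg₂)
        (setE₁_subset_setE hf₂) hg' hf' (Or.inl hg₂)]
  rcases h with h | h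
  · exact key hfg h hf hg hf₂ hg₂ hf' hg'
  · rw [finitePotentTrace_commutator_swap hfg.symm hg₁ hf₁ hg hf (Or.inl h),
      key hfg.symm h hg hf hg₂ hf₂ hg' hf',
      ← finitePotentTrace_commutator_swap hfg.symm (setE₁_subset_setE hg₂)
        (setE₁_subset_setE hf₂) hg' hf' (Or.inl hg₂)]

theorem IsProj.mul_mem_setE₁ {π : Module.End k V} (hπ : LinearMap.IsProj A π)
    (f : Module.End k V) : π * f ∈ setE₁ A :=
  mem_almostMapsTo_of_le (X := ⊤) (by rintro _ ⟨x, -, rfl⟩; exact hπ.map_mem _)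

theorem IsProj.sub_mul_mem_setE₂ {π : Module.End k V} (hπ : LinearMap.IsProj A π)
    {f : Module.End k V} (hf : f ∈ setE A) : f - π * f ∈ setE₂ A := by
  have h : 1 - π ∈ almostMapsTo A (⊥ : Submodule k V) := mem_almostMapsTo_of_le (by
    rintro _ ⟨x, hx, rfl⟩
    simp [hπ.map_id x hx])
  have := mul_mem_almostMapsTo h hf
  rwa [sub_mul, one_mul] at this

end Trace

/-! ### Existence and uniqueness of the residue. -/

section Residue

variable {k K V : Type*} [Field k] [CommRing K] [Algebra k K]
  [AddCommGroup V] [Module k V] [Module K V] [IsScalarTower k K V]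

theorem act_mul (f g : K) : (act k K (f * g) : Module.End k V) = act k K f * act k K g :=
  map_mul (Algebra.lsmul k k V) f g

theorem act_mul_comm (f g : K) :
    (act k K f * act k K g : Module.End k V) = act k K g * act k K f := by
  rw [← act_mul, mul_comm, act_mul]

theorem kaehler_linearMap_ext {r r' : Ω[K⁄k] →ₗ[k] k}
    (h : ∀ f g : K, r (f • KaehlerDifferential.D k K g) = r' (f • KaehlerDifferential.D k K g)) :
    r = r' := by
  refine LinearMap.ext fun x => ?_
  obtain ⟨y, rfl⟩ := KaehlerDifferential.linearCombination_surjective k K x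
  induction y using Finsupp.induction_linear with
  | zero => simp
  | add y z hy hz => simp only [map_add, hy, hz]
  | single g f => simpa using h f g

/-- A bilinear form `B` with `B (f, gh) = B (fg, h) + B (fh, g)` gives a functional on
differentials. -/
theorem exists_kaehler_linearMap (B : K →ₗ[k] K →ₗ[k] k)
    (hB : ∀ f g h, B f (g * h) = B (f * g) h + B (f * h) g) :
    ∃ r : Ω[K⁄k] →ₗ[k] k, ∀ f g, r (f • KaehlerDifferential.D k K g) = B f g := by
  let L : (K →₀ K) →ₗ[k] k := Finsupp.lsum k fun g => B.flip g
  have hL : ∀ f g, L (Finsupp.single g f) = B f g := fun f g => by simp [L]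
  let T : (K →₀ K) →ₗ[k] Ω[K⁄k] :=
    (Finsupp.linearCombination K (KaehlerDifferential.D k K)).restrictScalars k
  have hT : ∀ f g, T (Finsupp.single g f) = f • KaehlerDifferential.D k K g := fun f g => by
    simp [T]
  have h1 : ∀ f, B f 1 = 0 := fun f => by simpa using hB f 1 1
  have hker : ∀ x, T x = 0 → L x = 0 := by
    intro x hx
    have hx' : x ∈ KaehlerDifferential.kerTotal k K := by
      rw [← KaehlerDifferential.kerTotal_eq]; exact hx
    clear hx
    -- `L` is only `k`-linear while the relations span over `K`, so the induction must carry all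
    -- multiples.
    have main : ∀ s : K, L (s • x) = 0 := by
      unfold KaehlerDifferential.kerTotal at hx'
      induction hx' using Submodule.span_induction with
      | mem x hx =>
        rintro s
        rcases hx with (⟨⟨y, z⟩, rfl⟩ | ⟨⟨y, z⟩, rfl⟩) | ⟨c, rfl⟩
        · simp [smul_sub, smul_add, hL]
        · simp only [smul_sub, smul_add, Finsupp.smul_single, smul_eq_mul, mul_one, map_sub,
            map_add, hL, hB]
          ring
        · simp [hL, Algebra.algebraMap_eq_smul_one, h1]
      | zero => simp
      | add x y _ _ hx hy => intro s; rw [smul_add, map_add, hx, hy, add_zero]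
      | smul a x _ hx => intro s; rw [smul_smul, hx]
    simpa using main 1
  obtain ⟨s, hs⟩ := T.exists_rightInverse_of_surjective
    (LinearMap.range_eq_top.2 (KaehlerDifferential.linearCombination_surjective k K))
  refine ⟨L ∘ₗ s, fun f g => ?_⟩
  rw [← hT, ← hL, LinearMap.comp_apply, ← sub_eq_zero, ← map_sub]
  apply hker
  rw [map_sub, sub_eq_zero]
  exact LinearMap.congr_fun hs _

theorem exists_isResidue (A : Submodule k V) {π : Module.End k V} (hπ : LinearMap.IsProj A π)
    (hK : ∀ f : K, (act k K f : Module.End k V) ∈ setE A) :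
    ∃ r : Ω[K⁄k] →ₗ[k] k, IsResidue k K A r := by
  -- A lift that is linear in `f`, which makes `B` bilinear.
  let p : K →ₗ[k] Module.End k V :=
    LinearMap.mulLeft k π ∘ₗ (Algebra.lsmul k k V : K →ₐ[k] Module.End k V).toLinearMap
  have hp₁ : ∀ f, p f ∈ setE₁ A := fun f => IsProj.mul_mem_setE₁ hπ _
  have hp : ∀ f, p f ∈ setE A := fun f => setE₁_subset_setE (hp₁ f)
  have hp₂ : ∀ f, act k K f - p f ∈ setE₂ A := fun f => IsProj.sub_mul_mem_setE₂ hπ (hK f)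
  have hc : ∀ f g, p f * p g - p g * p f ∈ setE₀ A := fun f g =>
    commutator_mem_setE₀ (act_mul_comm f g) (hp f) (hp g) (hp₂ f) (hp₂ g) (Or.inl (hp₁ f))
  let B : K →ₗ[k] K →ₗ[k] k := LinearMap.mk₂ k
    (fun f g => traceE₀ A ⟨p f * p g - p g * p f, hc f g⟩)
    (fun f f' g => by
      rw [← map_add]; congr 1; ext1
      simp only [map_add, add_mul, mul_add, Submodule.coe_add]; abel)
    (fun c f g => by
      rw [← map_smul]; congr 1; ext1
      simp only [map_smul, smul_mul_assoc, mul_smul_comm, Submodule.coe_smul, smul_sub])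
    (fun f g g' => by
      rw [← map_add]; congr 1; ext1
      simp only [map_add, add_mul, mul_add, Submodule.coe_add]; abel)
    (fun c f g => by
      rw [← map_smul]; congr 1; ext1
      simp only [map_smul, smul_mul_assoc, mul_smul_comm, Submodule.coe_smul, smul_sub])
  have hBp : ∀ (f g : K) (f₁ g₁ : Module.End k V), f₁ ∈ setE A → g₁ ∈ setE A →
      act k K f - f₁ ∈ setE₂ A → act k K g - g₁ ∈ setE₂ A → (f₁ ∈ setE₁ A ∨ g₁ ∈ setE₁ A) →
      B f g = finitePotentTrace (f₁ * g₁ - g₁ * f₁) := fun f g f₁ g₁ hf₁ hg₁ hf hg h =>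
    (commutator_trace_congr (act_mul_comm f g) hf₁ hg₁ hf hg h (hp₁ f) (hp₁ g) (hp₂ f)
      (hp₂ g)).symm
  have hmulE₁ : ∀ f g, p f * p g ∈ setE₁ A := fun f g =>
    mul_mem_almostMapsTo (Y := A) (hp f) (hp₁ g)
  have hmul : ∀ f g, act k K (f * g) - p f * p g ∈ setE₂ A := by
    intro f g
    have h : act k K (f * g) - p f * p g =
        act k K f * (act k K g - p g) + (act k K f - p f) * p g := by
      rw [act_mul, mul_sub, sub_mul]; abel
    rw [h]
    exact (almostMapsTo A ⊥).add_mem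
      (mul_mem_almostMapsTo (Y := ⊥) (mem_almostMapsTo_of_le (by simp)) (hp₂ g))
      (mul_mem_almostMapsTo (Y := A) (hp₂ f) (hp g))
  have hB : ∀ f g h, B f (g * h) = B (f * g) h + B (f * h) g := by
    intro f g h
    have e₁ := hBp f (g * h) (p f) (p g * p h) (hp f) (setE₁_subset_setE (hmulE₁ g h))
      (hp₂ f) (hmul g h) (Or.inl (hp₁ f))
    have e₂ := hBp (f * g) h (p f * p g) (p h) (setE₁_subset_setE (hmulE₁ f g)) (hp h)
      (hmul f g) (hp₂ h) (Or.inr (hp₁ h))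
    -- The lift of `f h` is taken in the order `p h * p f` so that `[a, b c] = [a b, c] + [c a, b]`
    -- applies.
    have e₃ := hBp (f * h) g (p h * p f) (p g) (setE₁_subset_setE (hmulE₁ h f)) (hp g)
      (by rw [mul_comm f h]; exact hmul h f) (hp₂ g) (Or.inr (hp₁ g))
    rw [e₁, e₂, e₃, ← finitePotentTrace_add_of_mem (A := A)
      (commutator_mem_setE₀ (act_mul_comm (f * g) h) (setE₁_subset_setE (hmulE₁ f g)) (hp h)
        (hmul f g) (hp₂ h) (Or.inr (hp₁ h)))
      (commutator_mem_setE₀ (act_mul_comm (h * f) g) (setE₁_subset_setE (hmulE₁ h f)) (hp g)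
        (hmul h f) (hp₂ g) (Or.inr (hp₁ g)))]
    congr 1
    simp only [mul_assoc]
    abel
  obtain ⟨r, hr⟩ := exists_kaehler_linearMap B hB
  exact ⟨r, fun f g f₁ g₁ hf₁ hg₁ hf hg h => (hr f g).trans (hBp f g f₁ g₁ hf₁ hg₁ hf hg h)⟩

theorem exists_isProj (A : Submodule k V) : ∃ π : Module.End k V, LinearMap.IsProj A π := by
  obtain ⟨ρ, hρ⟩ := A.subtype.exists_leftInverse_of_injective A.ker_subtype
  refine ⟨A.subtype ∘ₗ ρ, ⟨fun x => (ρ x).2, fun x hx => ?_⟩⟩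
  exact congrArg Subtype.val (LinearMap.congr_fun hρ ⟨x, hx⟩)

theorem IsResidue.apply_of_isProj {A : Submodule k V} {r : Ω[K⁄k] →ₗ[k] k}
    (hr : IsResidue k K A r) (hK : ∀ f : K, (act k K f : Module.End k V) ∈ setE A)
    {π : Module.End k V} (hπ : LinearMap.IsProj A π) (f g : K) :
    r (f • KaehlerDifferential.D k K g) =
      finitePotentTrace (π * act k K f * (π * act k K g) - π * act k K g * (π * act k K f)) :=
  hr f g _ _ (setE₁_subset_setE (IsProj.mul_mem_setE₁ hπ _))
    (setE₁_subset_setE (IsProj.mul_mem_setE₁ hπ _)) (IsProj.sub_mul_mem_setE₂ hπ (hK f))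
    (IsProj.sub_mul_mem_setE₂ hπ (hK g)) (Or.inl (IsProj.mul_mem_setE₁ hπ _))

theorem existsUnique_isResidue (A : Submodule k V)
    (hK : ∀ f : K, (act k K f : Module.End k V) ∈ setE A) :
    ∃! r : Ω[K⁄k] →ₗ[k] k, IsResidue k K A r := by
  obtain ⟨π, hπ⟩ := exists_isProj A
  obtain ⟨r, hr⟩ := exists_isResidue A hπ hK
  refine ⟨r, hr, fun r' hr' => kaehler_linearMap_ext fun f g => ?_⟩
  rw [hr.apply_of_isProj hK hπ, IsResidue.apply_of_isProj hr' hK hπ]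

theorem isResidue_res {A : Submodule k V}
    (hK : ∀ f : K, (act k K f : Module.End k V) ∈ setE A) : IsResidue k K A (res k K A) := by
  have h := (existsUnique_isResidue A hK).exists
  unfold res
  rw [dif_pos h]
  exact h.choose_spec

end Residue

/-! ### Endomorphisms of products. -/

section Product

variable {k I : Type*} [Field k] {M : I → Type*} [∀ i, AddCommGroup (M i)] [∀ i, Module k (M i)]

/-- The endomorphism of a product that acts by `φ i` on the `i`-th factor. -/
def piEnd (φ : ∀ i, Module.End k (M i)) : Module.End k (∀ i, M i) :=
  LinearMap.pi fun i => φ i ∘ₗ LinearMap.proj i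

@[simp]
theorem piEnd_apply (φ : ∀ i, Module.End k (M i)) (x : ∀ i, M i) (i : I) :
    piEnd φ x i = φ i (x i) := rfl

theorem isProj_piEnd {A : ∀ i, Submodule k (M i)} {π : ∀ i, Module.End k (M i)}
    (hπ : ∀ i, LinearMap.IsProj (A i) (π i)) :
    LinearMap.IsProj (Submodule.pi Set.univ A) (piEnd π) :=
  ⟨fun _ i _ => (hπ i).map_mem _, fun _ hx => funext fun i => (hπ i).map_id _ (hx i trivial)⟩

open Classical in
/-- The endomorphism of a product that acts by `φ i` on the `i`-th factor and by zero on the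
others. -/
noncomputable def singleEnd (i : I) (φ : Module.End k (M i)) : Module.End k (∀ i, M i) :=
  LinearMap.single k M i ∘ₗ φ ∘ₗ LinearMap.proj i

theorem singleEnd_apply_same (i : I) (φ : Module.End k (M i)) (x : ∀ i, M i) :
    singleEnd i φ x i = φ (x i) := by
  simp [singleEnd]

theorem singleEnd_apply_of_ne {i j : I} (h : j ≠ i) (φ : Module.End k (M i)) (x : ∀ i, M i) :
    singleEnd i φ x j = 0 := by
  simp [singleEnd, h]

theorem sum_singleEnd_apply_of_mem {S : Finset I} (φ : ∀ i, Module.End k (M i)) (x : ∀ i, M i)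
    {i : I} (hi : i ∈ S) : (∑ j ∈ S, singleEnd j (φ j)) x i = φ i (x i) := by
  rw [LinearMap.sum_apply, Finset.sum_apply, Finset.sum_eq_single_of_mem i hi
    fun j _ hj => singleEnd_apply_of_ne hj.symm _ _, singleEnd_apply_same]

theorem sum_singleEnd_apply_of_notMem {S : Finset I} (φ : ∀ i, Module.End k (M i))
    (x : ∀ i, M i) {i : I} (hi : i ∉ S) : (∑ j ∈ S, singleEnd j (φ j)) x i = 0 := by
  rw [LinearMap.sum_apply, Finset.sum_apply]
  exact Finset.sum_eq_zero fun j hj =>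
    singleEnd_apply_of_ne (fun h : i = j => hi (h ▸ hj)) _ _

theorem singleEnd_mem_setE {A : ∀ i, Submodule k (M i)} {i : I} {φ : Module.End k (M i)}
    (hφ : φ ∈ setE (A i)) : singleEnd i φ ∈ setE (Submodule.pi Set.univ A) := by
  classical
  have hp : (Submodule.pi Set.univ A).map (LinearMap.proj i) ≤ A i := by
    rintro _ ⟨x, hx, rfl⟩
    exact hx i trivial
  have hs : (A i).map (LinearMap.single k M i) ≤ Submodule.pi Set.univ A := by
    rintro _ ⟨x, hx, rfl⟩ j -
    rcases eq_or_ne j i with rfl | h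
    · simpa using hx
    · simp [h]
  change AlmostLE _ _
  have h : AlmostLE ((A i).map (LinearMap.single k M i ∘ₗ φ)) (Submodule.pi Set.univ A) := by
    rw [Submodule.map_comp]
    exact (AlmostLE.map hφ _).trans (AlmostLE.of_le hs)
  refine h.mono_left ?_
  unfold singleEnd
  rw [← LinearMap.comp_assoc, Submodule.map_comp]
  exact Submodule.map_mono hp

/-- Infinitely many finite dimensional errors could add up to an infinite dimensional one; here they
occur only in `S`, and the rest preserves the product exactly. -/
theorem piEnd_mem_setE {A : ∀ i, Submodule k (M i)} {φ : ∀ i, Module.End k (M i)}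
    (hφ : ∀ i, φ i ∈ setE (A i)) (S : Finset I) (hS : ∀ i ∉ S, (A i).map (φ i) ≤ A i) :
    piEnd φ ∈ setE (Submodule.pi Set.univ A) := by
  rw [← sub_add_cancel (piEnd φ) (∑ i ∈ S, singleEnd i (φ i))]
  refine (almostMapsTo _ _).add_mem (mem_almostMapsTo_of_le ?_)
    ((almostMapsTo _ _).sum_mem fun i _ => singleEnd_mem_setE (hφ i))
  rintro _ ⟨x, hx, rfl⟩ i -
  rw [LinearMap.sub_apply, Pi.sub_apply, piEnd_apply]
  by_cases hi : i ∈ S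
  · rw [sum_singleEnd_apply_of_mem _ _ hi, sub_self]
    exact zero_mem _
  · rw [sum_singleEnd_apply_of_notMem _ _ hi, sub_zero]
    exact hS i hi (Submodule.mem_map_of_mem (hx i trivial))

/-- Cyclicity of the trace, as `proj i ∘ single i = id`. -/
theorem finitePotentTrace_singleEnd (i : I) (φ : Module.End k (M i))
    (h : IsFinitePotent φ) : finitePotentTrace (singleEnd i φ) = finitePotentTrace φ := by
  classical
  have e : (LinearMap.proj i ∘ₗ LinearMap.single k M i : Module.End k (M i)) = LinearMap.id := by
    ext x; simp
  have e' : (φ ∘ₗ LinearMap.proj i) ∘ₗ LinearMap.single k M i = φ := by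
    rw [LinearMap.comp_assoc, e, LinearMap.comp_id]
  have := finitePotentTrace_comp_comm (φ ∘ₗ LinearMap.proj i) (LinearMap.single k M i)
    (by rwa [e'])
  rw [e'] at this
  exact this.symm

/-- The trace of an endomorphism of a product that acts factorwise, and with square zero on almost
all factors. -/
theorem finitePotentTrace_piEnd {A : ∀ i, Submodule k (M i)} {φ : ∀ i, Module.End k (M i)}
    (hφ : piEnd φ ∈ setE₀ (Submodule.pi Set.univ A)) (hφ' : ∀ i, IsFinitePotent (φ i))
    (S : Finset I) (hS : ∀ i ∉ S, φ i * φ i = 0) :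
    finitePotentTrace (piEnd φ) = ∑ i ∈ S, finitePotentTrace (φ i) := by
  classical
  have hs : ∀ i, singleEnd i (φ i) ∈ setE₀ (Submodule.pi Set.univ A) := by
    intro i
    have h : singleEnd i (φ i) = singleEnd i 1 * piEnd φ := LinearMap.ext fun x => rfl
    rw [h]
    exact mul_mem_setE₀_of_E_E₀ (singleEnd_mem_setE (AlmostLE.of_le (by
      rw [Module.End.one_eq_id, Submodule.map_id]))) hφ
  have hsum := (setE₀ (Submodule.pi Set.univ A)).sum_mem (t := S) fun i _ => hs i
  -- All factors outside `S` are disposed of at once, so no infinite sum of traces arises.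
  have hsq : (piEnd φ - ∑ i ∈ S, singleEnd i (φ i)) *
      (piEnd φ - ∑ i ∈ S, singleEnd i (φ i)) = 0 := by
    have key : ∀ x i, (piEnd φ - ∑ i ∈ S, singleEnd i (φ i)) x i =
        if i ∈ S then 0 else φ i (x i) := by
      intro x i
      rw [LinearMap.sub_apply, Pi.sub_apply, piEnd_apply]
      split_ifs with hi
      · rw [sum_singleEnd_apply_of_mem _ _ hi, sub_self]
      · rw [sum_singleEnd_apply_of_notMem _ _ hi, sub_zero]
    ext x i
    rw [Module.End.mul_apply, key, key]
    split_ifs with hi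
    · rfl
    · exact LinearMap.congr_fun (hS i hi) (x i)
  rw [← sub_add_cancel (piEnd φ) (∑ i ∈ S, singleEnd i (φ i)),
    finitePotentTrace_add_of_mem (sub_mem hφ hsum) hsum, finitePotentTrace_of_sq_eq_zero _ hsq,
    zero_add, finitePotentTrace_sum_of_mem _ _ hs]
  exact Finset.sum_congr rfl fun i _ => finitePotentTrace_singleEnd i _ (hφ' i)

end Product

/-! ### Commutators of truncations. -/

section Projection

variable {k V : Type*} [Field k] [AddCommGroup V] [Module k V]

theorem IsProj.commutator_mem_setE₀ {A : Submodule k V} {π f g : Module.End k V}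
    (hπ : LinearMap.IsProj A π) (hfg : f * g = g * f) (hf : f ∈ setE A) (hg : g ∈ setE A) :
    π * f * (π * g) - π * g * (π * f) ∈ setE₀ A :=
  TateResidue.commutator_mem_setE₀ hfg
    (setE₁_subset_setE (IsProj.mul_mem_setE₁ hπ _)) (setE₁_subset_setE (IsProj.mul_mem_setE₁ hπ _))
    (IsProj.sub_mul_mem_setE₂ hπ hf) (IsProj.sub_mul_mem_setE₂ hπ hg)
    (Or.inl (IsProj.mul_mem_setE₁ hπ _))

/-- If commuting endomorphisms `f` and `g` preserve `A`, the commutator of their truncations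
vanishes on `A`, into which it maps. -/
theorem commutator_sq_eq_zero {A : Submodule k V} {π f g : Module.End k V}
    (hπ : LinearMap.IsProj A π) (hfg : f * g = g * f) (hf : A.map f ≤ A) (hg : A.map g ≤ A) :
    (π * f * (π * g) - π * g * (π * f)) * (π * f * (π * g) - π * g * (π * f)) = 0 := by
  have hf' : ∀ x ∈ A, f x ∈ A := fun x hx => hf (Submodule.mem_map_of_mem hx)
  have hg' : ∀ x ∈ A, g x ∈ A := fun x hx => hg (Submodule.mem_map_of_mem hx)
  have h : ∀ x ∈ A, (π * f * (π * g) - π * g * (π * f)) x = 0 := by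
    intro x hx
    simp only [LinearMap.sub_apply, Module.End.mul_apply]
    rw [hπ.map_id _ (hf' _ hx), hπ.map_id _ (hg' _ hx), hπ.map_id _ (hf' _ (hg' _ hx)),
      hπ.map_id _ (hg' _ (hf' _ hx)), sub_eq_zero]
    exact LinearMap.congr_fun hfg x
  ext x
  exact h _ (sub_mem (hπ.map_mem _) (hπ.map_mem _))

end Projection

/-! ### The family `V_i ⊆ W_i` and the residue of its product. -/

section Family

variable {k K V I : Type*} [Field k] [CommRing K] [Algebra k K]
  [AddCommGroup V] [Module k V] [Module K V] [IsScalarTower k K V]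
  {Vs : I → Submodule k V} {W : I → Submodule K V}

theorem map_subtype_localSubspace (hVW : ∀ i, Vs i ≤ (W i).restrictScalars k) (i : I) :
    (localSubspace k Vs W i).map ((W i).subtype.restrictScalars k) = Vs i := by
  refine le_antisymm (Submodule.map_comap_le _ _) fun x hx => ?_
  exact ⟨⟨x, hVW i hx⟩, hx, rfl⟩

theorem map_subtype_map_act (hVW : ∀ i, Vs i ≤ (W i).restrictScalars k) (i : I) (f : K) :
    ((localSubspace k Vs W i).map (act k K f)).map ((W i).subtype.restrictScalars k) =
      (Vs i).map (act k K f) := by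
  conv_rhs => rw [← map_subtype_localSubspace hVW i]
  rw [← Submodule.map_comp, ← Submodule.map_comp]
  rfl

theorem act_mem_setE_localSubspace (hVW : ∀ i, Vs i ≤ (W i).restrictScalars k) (i : I) {f : K}
    (hf : AlmostLE ((Vs i).map (act k K f)) (Vs i)) :
    (act k K f : Module.End k (W i)) ∈ setE (localSubspace k Vs W i) := by
  refine AlmostLE.of_map ((W i).subtype.restrictScalars k) (W i).injective_subtype ?_
  rwa [map_subtype_map_act hVW, map_subtype_localSubspace hVW]

theorem map_act_localSubspace_le (i : I) {f : K} (hf : (Vs i).map (act k K f) ≤ Vs i) :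
    (localSubspace k Vs W i).map (act k K f) ≤ localSubspace k Vs W i := by
  rintro _ ⟨x, hx, rfl⟩
  exact hf (Submodule.mem_map_of_mem (f := act k K f) hx)

/-- All but finitely many `V i` are stable under `f`. -/
theorem exists_finset_map_le {f : Module.End k V} (hf : f ∈ restrictedEnd Vs) :
    ∃ S : Finset I, ∀ i ∉ S, (Vs i).map f ≤ Vs i := by
  refine ⟨hf.2.toFinset, fun i hi => ?_⟩
  rw [Set.Finite.mem_toFinset, Set.mem_ofPred_eq, not_not] at hi
  exact hi.elim (fun h => h.le) (fun h => h.trans_le bot_le)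

theorem act_mem_setE_productSubspace (hVW : ∀ i, Vs i ≤ (W i).restrictScalars k) {f : K}
    (hf : act k K f ∈ restrictedEnd Vs) :
    (act k K f : Module.End k (∀ i, W i)) ∈ setE (productSubspace k Vs W) := by
  obtain ⟨S, hS⟩ := exists_finset_map_le hf
  exact piEnd_mem_setE (φ := fun i => act k K f)
    (fun i => act_mem_setE_localSubspace hVW i (hf.1 i)) S
    fun i hi => map_act_localSubspace_le i (hS i hi)

/-- The residue of a product is the sum of the residues of the factors. -/
theorem res_productSubspace (hVW : ∀ i, Vs i ≤ (W i).restrictScalars k)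
    (hK : ∀ g : K, act k K g ∈ restrictedEnd Vs) (g h : K) :
    ∃ S : Finset I,
      (∀ i ∉ S, res k K (localSubspace k Vs W i) (g • KaehlerDifferential.D k K h) = 0) ∧
      res k K (productSubspace k Vs W) (g • KaehlerDifferential.D k K h) =
        ∑ i ∈ S, res k K (localSubspace k Vs W i) (g • KaehlerDifferential.D k K h) := by
  classical
  have hE : ∀ i, ∀ f : K, (act k K f : Module.End k (W i)) ∈ setE (localSubspace k Vs W i) :=
    fun i f => act_mem_setE_localSubspace hVW i ((hK f).1 i)
  have hE' : ∀ f : K, (act k K f : Module.End k (∀ i, W i)) ∈ setE (productSubspace k Vs W) :=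
    fun f => act_mem_setE_productSubspace hVW (hK f)
  choose π hπ using fun i => exists_isProj (localSubspace k Vs W i)
  have hπ' : LinearMap.IsProj (productSubspace k Vs W) (piEnd π) := isProj_piEnd hπ
  set φ : ∀ i, Module.End k (W i) := fun i =>
    π i * act k K g * (π i * act k K h) - π i * act k K h * (π i * act k K g) with hφdef
  have hφ : ∀ i, φ i ∈ setE₀ (localSubspace k Vs W i) := fun i =>
    IsProj.commutator_mem_setE₀ (hπ i) (act_mul_comm g h) (hE i g) (hE i h)
  -- `K` acts diagonally, so truncating by `piEnd π` is truncating in each factor.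
  have hpi : piEnd π * act k K g * (piEnd π * act k K h) -
      piEnd π * act k K h * (piEnd π * act k K g) = piEnd φ := by
    ext x i
    rfl
  have hφ' : piEnd φ ∈ setE₀ (productSubspace k Vs W) :=
    hpi ▸ IsProj.commutator_mem_setE₀ hπ' (act_mul_comm g h) (hE' g) (hE' h)
  have hres : ∀ i, res k K (localSubspace k Vs W i) (g • KaehlerDifferential.D k K h) =
      finitePotentTrace (φ i) := fun i =>
    (isResidue_res (hE i)).apply_of_isProj (hE i) (hπ i) g h
  have hres' : res k K (productSubspace k Vs W) (g • KaehlerDifferential.D k K h) =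
      finitePotentTrace (piEnd φ) := by
    rw [← hpi]
    exact (isResidue_res hE').apply_of_isProj hE' hπ' g h
  obtain ⟨S, hS⟩ := exists_finset_map_le (hK g)
  obtain ⟨T, hT⟩ := exists_finset_map_le (hK h)
  have hsq : ∀ i ∉ S ∪ T, φ i * φ i = 0 := fun i hi => by
    rw [Finset.notMem_union] at hi
    exact commutator_sq_eq_zero (hπ i) (act_mul_comm g h)
      (map_act_localSubspace_le i (hS i hi.1)) (map_act_localSubspace_le i (hT i hi.2))
  refine ⟨S ∪ T, fun i hi => ?_, ?_⟩
  · rw [hres, finitePotentTrace_of_sq_eq_zero _ (hsq i hi)]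
  · rw [hres', finitePotentTrace_piEnd hφ' (fun i => isFinitePotent_of_mem_setE₀ (hφ i)) _ hsq]
    exact Finset.sum_congr rfl fun i _ => (hres i).symm

end Family

end TateResidue

theorem mainTheorem8 {k K V I : Type*} [Field k] [CommRing K] [Algebra k K]
    [AddCommGroup V] [Module k V] [Module K V] [IsScalarTower k K V]
    (Vs : I → Submodule k V) (W : I → Submodule K V)
    (hVW : ∀ i, Vs i ≤ (W i).restrictScalars k)
    (hK : ∀ g : K, TateResidue.act k K g ∈ TateResidue.restrictedEnd Vs) :
    -- the residue maps in question exist and are unique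
    (∃! r : Ω[K⁄k] →ₗ[k] k,
      TateResidue.IsResidue k K (TateResidue.productSubspace k Vs W) r) ∧
    (∀ i, ∃! r : Ω[K⁄k] →ₗ[k] k,
      TateResidue.IsResidue k K (TateResidue.localSubspace k Vs W i) r) ∧
    -- the reciprocity law
    ∀ g h : K,
      {i | TateResidue.res k K (TateResidue.localSubspace k Vs W i)
        (g • KaehlerDifferential.D k K h) ≠ 0}.Finite ∧
      TateResidue.res k K (TateResidue.productSubspace k Vs W)
          (g • KaehlerDifferential.D k K h) =
        ∑ᶠ i, TateResidue.res k K (TateResidue.localSubspace k Vs W i)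
          (g • KaehlerDifferential.D k K h) ∧
      (TateResidue.res k K (TateResidue.productSubspace k Vs W)
          (g • KaehlerDifferential.D k K h) = 0 →
        ∑ᶠ i, TateResidue.res k K (TateResidue.localSubspace k Vs W i)
          (g • KaehlerDifferential.D k K h) = 0) := by
  have hprod : ∀ f : K, (TateResidue.act k K f : Module.End k (∀ i, W i)) ∈
      TateResidue.setE (TateResidue.productSubspace k Vs W) :=
    fun f => TateResidue.act_mem_setE_productSubspace hVW (hK f)
  refine ⟨TateResidue.existsUnique_isResidue _ hprod,
    fun i => TateResidue.existsUnique_isResidue _ fun f =>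
      TateResidue.act_mem_setE_localSubspace hVW i ((hK f).1 i), fun g h => ?_⟩
  obtain ⟨S, hS, hsum⟩ := TateResidue.res_productSubspace (W := W) hVW hK g h
  have hsub : {i | TateResidue.res k K (TateResidue.localSubspace k Vs W i)
      (g • KaehlerDifferential.D k K h) ≠ 0} ⊆ S := fun i hi =>
    by_contra fun hiS => hi (hS i hiS)
  rw [finsum_eq_sum_of_support_subset _ hsub, hsum]
  exact ⟨S.finite_toSet.subset hsub, rfl, id⟩
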